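/- Let $\mathcal M$ be a class of finite matroids closed under minors and isomorphism. For a matroid $M$ with ground set $E$ and rank function $r$, put $\lambda_M(X)=r(X)+r(E-X)-r(M)$. For $k\ge 1$, a partition $(A,B)$ of $E$ is a $k$-separation of $M$ if $|A|\ge k$, $|B|\ge k$ and $\lambda_M(A)\le k-1$; it is exact if $\lambda_M(A)=k-1$, and an exact $k$-separation is minimal if $|A|=k$ or $|B|=k$. A matroid is 3-connected if it has no 1-separation and no 2-separation. A matroid $M$ is a single-element extension (coextension) of $N$ if $M\setminus e=N$ (respectively $M/e=N$) for some element $e$ of $M$. **Corollary 1.2** (Mayhew, Royle and Whittle). Let $N\in\mathcal M$ be 3-connected and neither a wheel nor a whirl, and let $(A,B)$ be a non-minimal exact 3-separation of $N$, where $A$ is a 4-element set that is both a circuit and a cocircuit of $N$. Suppose that $A$ is both a circuit and a cocircuit in every 3-connected single-element extension of $N$ in $\mathcal M$ and in every 3-connected single-element coextension of $N$ in $\mathcal M$. Then $N$ is a 3-decomposer, with inducer $(A,B)$, for every 3-connected matroid $M\in\mathcal M$ having an $N$-minor; that is, whenever $N$ is identified by an isomorphism with a minor of such an $M$, the matroid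 $M$ has an exact 3-separation $(X,Y)$ such that, under this identification, $A\subseteq X$ and $B\subseteq Y$. -/

import Mathlib

open Set

namespace Matroid

variable {α : Type*}

/-- The rank `r(X)` as a natural number. It is meant for finite matroids, where every rank is
finite. -/
noncomputable def natRk (M : Matroid α) (X : Set α) : ℕ := (M.eRk X).toNat

/-- The connectivity function `λ(X) = r(X) + r(E - X) - r(M)`. -/
noncomputable def connFn (M : Matroid α) (X : Set α) : ℤ :=
  (M.natRk X : ℤ) + (M.natRk (M.E \ X) : ℤ) - (M.natRk M.E : ℤ)

/-- `(A, B)` is a `k`-separation: a partition of the ground set with `|A|, |B| ≥ k` and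
`λ(A) ≤ k - 1`. (Used only for `k ≥ 1`.) -/
structure IsSeparation (M : Matroid α) (k : ℕ) (A B : Set α) : Prop where
  union_eq : A ∪ B = M.E
  disjoint : Disjoint A B
  le_left : (k : ℕ∞) ≤ A.encard
  le_right : (k : ℕ∞) ≤ B.encard
  conn_le : M.connFn A ≤ (k : ℤ) - 1

/-- An exact `k`-separation: a `k`-separation with `λ(A) = k - 1`. -/
def IsExactSeparation (M : Matroid α) (k : ℕ) (A B : Set α) : Prop :=
  M.IsSeparation k A B ∧ M.connFn A = (k : ℤ) - 1

/-- A minimal exact `k`-separation: an exact one in which one side has exactly `k` elements. -/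
def IsMinimalExactSeparation (M : Matroid α) (k : ℕ) (A B : Set α) : Prop :=
  M.IsExactSeparation k A B ∧ (A.encard = k ∨ B.encard = k)

/-- `M` is `n`-connected: it has no `k`-separation with `1 ≤ k ≤ n - 1`. (Used for `n = 3`.) -/
def IsNConnected (M : Matroid α) (n : ℕ) : Prop :=
  ∀ k : ℕ, 1 ≤ k → k < n → ∀ A B : Set α, ¬ M.IsSeparation k A B

/-- `M` is a single-element extension of `N`: `M \ e = N` for some element `e` of `M`. -/
def IsSingleExtension (M N : Matroid α) : Prop :=
  ∃ e ∈ M.E, M ＼ {e} = N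

/-- `M` is a single-element coextension of `N`: `M / e = N` for some element `e` of `M`. -/
def IsSingleCoextension (M N : Matroid α) : Prop :=
  ∃ e ∈ M.E, M ／ {e} = N

/-- `M` has an `N`-minor: some isomorphic copy of `N` is a minor of `M`. -/
def HasMinor (M N : Matroid α) : Prop :=
  ∃ (f : α → α) (hf : InjOn f N.E), N.map f hf ≤m M

/-- `N` is a `k`-decomposer for `M` having `(A, B)` as an inducer: whenever `N` is identified, by a
relabelling `f` of its elements, with a minor of `M`, the matroid `M` has an exact `k`-separation
`(X, Y)` with `A ⊆ X` and `B ⊆ Y` under this identification. When `N` itself is a minor of `M`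
one may take `f = id`. -/
def IsDecomposerFor (N : Matroid α) (k : ℕ) (A B : Set α) (M : Matroid α) : Prop :=
  ∀ (f : α → α) (hf : InjOn f N.E), N.map f hf ≤m M →
    ∃ X Y : Set α, M.IsExactSeparation k X Y ∧ f '' A ⊆ X ∧ f '' B ⊆ Y

/-- A class of finite matroids closed under minors and isomorphism. -/
structure IsMinorClosedClass (𝓜 : Set (Matroid α)) : Prop where
  finite : ∀ M ∈ 𝓜, M.Finite
  minor_mem : ∀ M ∈ 𝓜, ∀ M' : Matroid α, M' ≤m M → M' ∈ 𝓜
  map_mem : ∀ M ∈ 𝓜, ∀ (f : α → α) (hf : InjOn f M.E), M.map f hf ∈ 𝓜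

/-- The wheel graph with `r` spokes: a rim cycle on the vertices `some i`, and a hub `none`
adjacent to all of them. -/
def wheelGraph (r : ℕ) : SimpleGraph (Option (Fin r)) where
  Adj u v := u ≠ v ∧ (u = none ∨ v = none ∨
    ∃ i j, u = some i ∧ v = some j ∧ (SimpleGraph.cycleGraph r).Adj i j)
  symm := ⟨by
    rintro u v ⟨hne, h | h | ⟨i, j, hu, hv, hij⟩⟩
    · exact ⟨hne.symm, Or.inr (Or.inl h)⟩
    · exact ⟨hne.symm, Or.inl h⟩
    · exact ⟨hne.symm, Or.inr (Or.inr ⟨j, i, hv, hu, hij.symm⟩)⟩⟩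
  loopless := ⟨fun _ h => h.1 rfl⟩

/-- The rim of the wheel graph: the edges of the wheel avoiding the hub. -/
def wheelRim (r : ℕ) : Set (Sym2 (Option (Fin r))) :=
  {e ∈ (wheelGraph r).edgeSet | none ∉ e}

/-- `N` is (isomorphic to) a wheel: the cycle matroid of a wheel graph with `r ≥ 3` spokes,
whose independent sets are the edge sets of forests. -/
def IsWheel (N : Matroid α) : Prop :=
  ∃ r : ℕ, 3 ≤ r ∧ ∃ φ : α → Sym2 (Option (Fin r)), BijOn φ N.E (wheelGraph r).edgeSet ∧
    ∀ I ⊆ N.E, N.Indep I ↔ (SimpleGraph.fromEdgeSet (φ '' I)).IsAcyclic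

/-- `N` is (isomorphic to) a whirl: for rank `r ≥ 3` the matroid obtained from the rank-`r` wheel
by relaxing its rim, that is, by making the rim independent; for rank `2` the uniform matroid
`U_{2,4}`. -/
def IsWhirl (N : Matroid α) : Prop :=
  (N.E.encard = 4 ∧ ∀ I ⊆ N.E, N.Indep I ↔ I.encard ≤ 2) ∨
  ∃ r : ℕ, 3 ≤ r ∧ ∃ φ : α → Sym2 (Option (Fin r)), BijOn φ N.E (wheelGraph r).edgeSet ∧
    ∀ I ⊆ N.E, N.Indep I ↔
      ((SimpleGraph.fromEdgeSet (φ '' I)).IsAcyclic ∨ φ '' I = wheelRim r)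

end Matroid

open Set

namespace Matroid

/-! ### Natural-number rank under minors, duality and relabelling. -/

section Rank

variable {α : Type*} {M N : Matroid α} {C D X Y I : Set α} {e : α}

/-! Induction on the size of `M`, with 3-connectivity of `M` dropped, finds `X ⊇ A` disjoint from `B
= E(N) - A` with `λ_M(X) ≤ 2` (`IsStableQuad.splits`). Exactness comes afterwards: `λ` does not
increase in minors, and `λ_N(A) = 3 + 3 - 4 = 2`.

Write `N = M / C \ D` with `C` independent and `D` coindependent. If `A` is a circuit and a
cocircuit of `M`, take `X = A`. If it is not a circuit, restoring a single `c ∈ C` to `N` already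
raises `λ(A)` to at least 3 (`exists_three_le_connFn`); dually, if it is not a cocircuit, some `d ∈
D` does so.

If both fail, induction gives `X` in `M \ d` and `Y` in `M / c`. The choice of `c` and `d` forces `c
∈ X` and `d ∈ Y`, and uncrossing gives `λ_M(X ∪ Y) ≤ 2` (`splits_of_delete_of_contract`).

If only the cocircuit property fails, the extension of `N` by `d` cannot be 3-connected, by
hypothesis, so `d` is parallel to some `a ∈ A` (`exists_parallel`). Let `d` play the part of `a`,
apply induction to `M \ a`, and put `a` back: it lies in the closure of `A - a`. The remaining case
is dual. -/

lemma cast_natRk (M : Matroid α) [M.Finite] (X : Set α) : (M.natRk X : ℕ∞) = M.eRk X :=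
  ENat.natCast_toNat (M.isRkFinite_set X).eRk_lt_top.ne

lemma natRk_mono [M.Finite] (h : X ⊆ Y) : M.natRk X ≤ M.natRk Y := by
  have := M.eRk_mono h
  rw [← cast_natRk, ← cast_natRk] at this
  exact_mod_cast this

lemma natRk_submod (M : Matroid α) [M.Finite] (X Y : Set α) :
    M.natRk (X ∩ Y) + M.natRk (X ∪ Y) ≤ M.natRk X + M.natRk Y := by
  have := M.eRk_inter_add_eRk_union_le X Y
  simp only [← cast_natRk] at this
  exact_mod_cast this

lemma natRk_union_le (M : Matroid α) [M.Finite] (X Y : Set α) :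
    M.natRk (X ∪ Y) ≤ M.natRk X + M.natRk Y := by
  have := M.natRk_submod X Y
  lia

lemma natRk_insert_le (M : Matroid α) [M.Finite] (e : α) (X : Set α) :
    M.natRk (insert e X) ≤ M.natRk X + 1 := by
  have := M.eRk_insert_le_add_one e X
  simp only [← cast_natRk] at this
  exact_mod_cast this

lemma natRk_insert_of_mem_closure (he : e ∈ M.closure X) :
    M.natRk (insert e X) = M.natRk X := by
  rw [natRk, ← eRk_insert_closure_eq, insert_eq_of_mem he, eRk_closure_eq, natRk]

lemma natRk_inter_ground (M : Matroid α) (X : Set α) : M.natRk (X ∩ M.E) = M.natRk X := by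
  simp [natRk]

lemma natRk_delete (M : Matroid α) (D X : Set α) : (M ＼ D).natRk X = M.natRk (X \ D) := by
  rw [natRk, natRk, delete_eq_restrict, restrict_eRk_eq', ← inter_sdiff_assoc,
    inter_sdiff_right_comm, eRk_inter_ground]

lemma natRk_contract (M : Matroid α) [M.Finite] (C X : Set α) :
    (M ／ C).natRk X + M.natRk C = M.natRk (X ∪ C) := by
  obtain ⟨I, hI⟩ := M.exists_isBasis' C
  obtain ⟨J, hJ, hIJ⟩ := hI.indep.subset_isBasis'_of_subset
    (hI.subset.trans (subset_union_right (s := X)))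
  have hJC : J ∩ C = I := (hI.eq_of_subset_indep (hJ.indep.inter_right C)
    (subset_inter hIJ hI.subset) inter_subset_right).symm
  have hb := hJ.contract_isBasis' hI (hJ.indep.subset (union_subset sdiff_subset hIJ))
  have h1 : (M ／ C).eRk X = (J \ C).encard := by
    rw [hb.encard_eq_eRk, union_sdiff_right, ← eRk_inter_ground, ← (M ／ C).eRk_inter_ground (X \ C),
      contract_ground]
    congr 1
    ext; simp; tauto
  have h : (M ／ C).eRk X + M.eRk C = M.eRk (X ∪ C) := by
    rw [h1, hI.eRk_eq_encard, hJ.eRk_eq_encard, ← hJC, encard_sdiff_add_encard_inter]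
  simp only [← cast_natRk] at h
  exact_mod_cast h

lemma natRk_dual_add (M : Matroid α) [M.Finite] (hX : X ⊆ M.E) :
    M✶.natRk X + M.natRk M.E = M.natRk (M.E \ X) + X.ncard := by
  have h := M.eRk_dual_add_eRank X hX
  rw [← eRk_ground, ← (M.ground_finite.subset hX).cast_ncard_eq] at h
  simp only [← cast_natRk] at h
  exact_mod_cast h

lemma natRk_map {β : Type*} {f : α → β} (M : Matroid α) (hf : InjOn f M.E) (hX : X ⊆ M.E) :
    (M.map f hf).natRk (f '' X) = M.natRk X := by
  rw [natRk, eRk_map M hf hX, natRk]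

lemma IsCircuit.natRk_add_one [M.Finite] (hX : M.IsCircuit X) : M.natRk X + 1 = X.ncard := by
  have h := hX.eRk_add_one_eq
  rw [← (M.ground_finite.subset hX.subset_ground).cast_ncard_eq, ← cast_natRk] at h
  exact_mod_cast h

lemma indep_iff_natRk [M.Finite] (hI : I ⊆ M.E) : M.Indep I ↔ M.natRk I = I.ncard := by
  rw [indep_iff_eRk_eq_encard, ← (M.ground_finite.subset hI).cast_ncard_eq, ← cast_natRk,
    Nat.cast_inj]

end Rank

/-! ### The connectivity function under duality and minors. -/

section Connectivity

variable {α : Type*} {M N : Matroid α} {C D X Y : Set α}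

/-- The form of `λ` that is symmetric in `M` and its dual. -/
lemma connFn_eq_dual (M : Matroid α) [M.Finite] (hX : X ⊆ M.E) :
    M.connFn X = M.natRk X + M✶.natRk X - X.ncard := by
  have := M.natRk_dual_add hX
  rw [connFn]
  lia

lemma connFn_dual (M : Matroid α) [M.Finite] (hX : X ⊆ M.E) : M✶.connFn X = M.connFn X := by
  rw [connFn_eq_dual M hX, connFn_eq_dual M✶ hX, dual_dual]
  ring

lemma connFn_compl (M : Matroid α) (hX : X ⊆ M.E) : M.connFn (M.E \ X) = M.connFn X := by
  rw [connFn, connFn, sdiff_sdiff_cancel_left hX]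
  ring

lemma connFn_delete_le (M : Matroid α) [M.Finite] (D X : Set α) :
    (M ＼ D).connFn (X \ D) ≤ M.connFn X := by
  have h1 := M.natRk_submod X (M.E \ D)
  have h2 := M.natRk_submod (X ∪ (M.E \ D)) (M.E \ X)
  have h3 : M.natRk M.E ≤ M.natRk (X ∪ M.E \ D ∪ M.E \ X) := natRk_mono (by tauto_set)
  have e1 : X ∩ (M.E \ D) = (X \ D) ∩ M.E := by tauto_set
  have e2 : (X ∪ (M.E \ D)) ∩ (M.E \ X) = ((M.E \ D) \ (X \ D)) \ D := by tauto_set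
  rw [e1, natRk_inter_ground] at h1
  rw [e2] at h2
  simp only [connFn, natRk_delete, delete_ground, sdiff_idem]
  lia

lemma connFn_contract_le (M : Matroid α) [M.Finite] (C : Set α) (hX : X ⊆ M.E) :
    (M ／ C).connFn (X \ C) ≤ M.connFn X := by
  rw [← connFn_dual M hX, ← connFn_dual (M ／ C) (X := X \ C) (by simp; tauto_set), dual_contract]
  exact connFn_delete_le _ _ _

lemma IsMinor.finite [M.Finite] (h : N ≤m M) : N.Finite :=
  ⟨M.ground_finite.subset h.subset⟩

lemma IsMinor.connFn_le [M.Finite] (h : N ≤m M) (hX : X ⊆ M.E) (hXY : X ∩ N.E = Y) :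
    N.connFn Y ≤ M.connFn X := by
  obtain ⟨C, D, rfl⟩ := h
  have h1 := connFn_contract_le M C hX
  have h2 := connFn_delete_le (M ／ C) D (X \ C)
  have : Y = (X \ C) \ D := by
    rw [← hXY]; simp only [delete_ground, contract_ground]; tauto_set
  rw [this]
  exact h2.trans h1

lemma IsMinor.dual (h : N ≤m M) : N✶ ≤m M✶ := by
  obtain ⟨C, D, -, -, hCD, rfl⟩ := h.exists_eq_contract_delete_disjoint
  exact ⟨D, C, by rw [dual_contract_delete, contract_delete_comm _ hCD.symm]⟩

/-- With `I` a basis of the contracted set, its other elements become loops and may be deleted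
instead. With `J` a cobasis of the enlarged deleted set, the leftover elements are coloops of `M ＼
J`, so they may be contracted and keep `I` independent. -/
lemma IsMinor.exists_indep_coindep (h : N ≤m M) :
    ∃ C D, M.Indep C ∧ M.Coindep D ∧ Disjoint C D ∧ N = M ／ C ＼ D := by
  obtain ⟨C, D, hC, hD, hCD, rfl⟩ := h.exists_eq_contract_delete_disjoint
  obtain ⟨I, hI⟩ := M.exists_isBasis C
  have hss : C \ I ∪ D ⊆ M✶.E := union_subset (sdiff_subset.trans hC) hD
  obtain ⟨J, hJ⟩ := M✶.exists_isBasis (C \ I ∪ D) hss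
  have hdj : Disjoint I (C \ I ∪ D) :=
    disjoint_union_right.2 ⟨disjoint_sdiff_right, hCD.mono_left hI.subset⟩
  have hdJ : Disjoint I J := hdj.mono_right hJ.subset
  have hdel : M ＼ (C \ I ∪ D) = M ＼ J ／ ((C \ I ∪ D) \ J) := by
    rw [← dual_inj, dual_delete, hJ.contract_eq_contract_delete, dual_contract, dual_delete]
  have hco : (C \ I ∪ D) \ J ⊆ (M ＼ J).coloops := by
    rw [← dual_loops, dual_delete]
    exact hJ.sdiff_subset_loops_contract
  have hind : (M ＼ J).Indep (I ∪ (C \ I ∪ D) \ J) :=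
    (union_indep_iff_indep_of_subset_coloops hco).2 (hI.indep.indep_delete_of_disjoint hdJ)
  have hdj' : Disjoint (I ∪ (C \ I ∪ D) \ J) J := disjoint_union_left.2 ⟨hdJ, disjoint_sdiff_left⟩
  refine ⟨_, J, hind.of_delete, hJ.indep, hdj', ?_⟩
  rw [hI.contract_eq_contract_delete, delete_delete, contract_delete_comm _ hdj, hdel,
    contract_contract, union_comm _ I, ← contract_delete_comm _ hdj']

end Connectivity

/-! ### Restoring one element, uncrossing, and parallel extensions. -/

section Bridging

variable {α : Type*} {M N : Matroid α} {A B C D X Y : Set α} {a c d : α}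

/-- Some partition of the ground set of `M` separating `A` from `B` has connectivity at most `2`. -/
def Splits (M : Matroid α) (A B : Set α) : Prop :=
  ∃ X, A ⊆ X ∧ X ⊆ M.E ∧ Disjoint X B ∧ M.connFn X ≤ 2

lemma Splits.dual [M.Finite] (h : M.Splits A B) : M✶.Splits A B := by
  obtain ⟨X, hAX, hX, hXB, hc⟩ := h
  exact ⟨X, hAX, hX, hXB, by rwa [connFn_dual M hX]⟩

lemma IsNConnected.dual [M.Finite] {n : ℕ} (h : M.IsNConnected n) : M✶.IsNConnected n := by
  intro k hk hkn U V hUV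
  have hU : U ⊆ M.E := subset_union_left.trans hUV.union_eq.subset
  exact h k hk hkn U V ⟨hUV.union_eq, hUV.disjoint, hUV.le_left, hUV.le_right,
    by rw [← connFn_dual M hU]; exact hUV.conn_le⟩

lemma IsSeparation.symm {k : ℕ} (h : M.IsSeparation k A B) : M.IsSeparation k B A := by
  have hB : M.E \ A = B := by
    rw [← h.union_eq, union_sdiff_left, h.disjoint.symm.sdiff_eq_left]
  refine ⟨by rw [union_comm, h.union_eq], h.disjoint.symm, h.le_right, h.le_left, ?_⟩
  rw [← hB, connFn_compl M (subset_union_left.trans h.union_eq.subset)]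
  exact h.conn_le

/-- If contracting `C` turns `A` into a circuit of `N`, but `A` is not a circuit of `M`, then
uncontracting a single element already destroys the circuit `A`. -/
lemma exists_three_le_connFn [M.Finite] (hC : M.Indep C) (hCD : Disjoint C D)
    (hcard : A.encard = 4) (hA : (M ／ C ＼ D).IsCircuit A) (hA' : (M ／ C ＼ D).IsCocircuit A)
    (hM : ¬ M.IsCircuit A) :
    ∃ c ∈ C, M ／ (C \ {c}) ＼ D ／ {c} = M ／ C ＼ D ∧
      3 ≤ (M ／ (C \ {c}) ＼ D).connFn A := by
  have hcard' : A.ncard = 4 := by rw [ncard, hcard]; rfl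
  have hAE := hA.subset_ground
  simp only [delete_ground, contract_ground, subset_sdiff] at hAE
  -- `K` is a circuit of `M` with `A ⊆ K ⊆ A ∪ C`. It differs from `A`, so it supplies `c`.
  obtain ⟨K, hK, hAK, hKAC⟩ := hA.of_delete.exists_subset_isCircuit_of_contract
  obtain ⟨c, hcK, hcA⟩ : ∃ c ∈ K, c ∉ A := by
    by_contra! hcon
    exact hM (hAK.antisymm hcon ▸ hK)
  have hcC : c ∈ C := (hKAC hcK).resolve_left hcA
  have hcD : c ∉ D := hCD.notMem_of_mem_left hcC
  have hins : insert c (C \ {c}) = C := insert_sdiff_self_of_mem hcC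
  have heq : M ／ (C \ {c}) ＼ D ／ {c} = M ／ C ＼ D := by
    rw [contract_delete_contract _ _ _ _ (by simpa), union_singleton, hins]
  refine ⟨c, hcC, heq, ?_⟩
  have hco : (M ／ (C \ {c}) ＼ D).IsCocircuit A := by
    rw [← heq] at hA'
    exact hA'.of_contract
  have hr := hA.natRk_add_one
  have hr' := hco.isCircuit.natRk_add_one
  have hAD : A \ D = A := hAE.2.sdiff_eq_left
  rw [natRk_delete, hAD] at hr
  have h1 := natRk_contract M C A
  have h2 := natRk_contract M (C \ {c}) A
  have h3 := (indep_iff_natRk hC.subset_ground).1 hC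
  have h4 := (indep_iff_natRk (hC.subset sdiff_subset).subset_ground).1
    (hC.subset (sdiff_subset (t := {c})))
  have h5 := ncard_sdiff_singleton_add_one hcC (M.ground_finite.subset hC.subset_ground)
  -- The circuit `K` puts `c` in the closure of `A ∪ (C - c)`. As `C` is independent, not
  -- contracting `c` makes the rank of `A` rise from 3 to 4.
  have h6 : M.natRk (A ∪ C) = M.natRk (A ∪ (C \ {c})) := by
    rw [← natRk_insert_of_mem_closure (e := c) (X := A ∪ (C \ {c})), ← union_insert, hins]
    refine M.closure_subset_closure ?_ (hK.mem_closure_sdiff_singleton_of_mem hcK)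
    rintro x ⟨hxK, hxc⟩
    exact (hKAC hxK).imp id fun h => ⟨h, hxc⟩
  have hsub : A ⊆ (M ／ (C \ {c}) ＼ D).E := hco.subset_ground
  -- Rank 4, corank 3, size 4: `λ(A) = 4 + 3 - 4`.
  rw [connFn_eq_dual _ hsub, natRk_delete, hAD]
  lia

/-- Uncrossing a separation of `M ＼ {d}` with one of `M ／ {c}`. -/
lemma splits_of_delete_of_contract [M.Finite] (hX : X ⊆ M.E \ {d}) (hY : Y ⊆ M.E \ {c})
    (hcX : c ∈ X) (hdY : d ∈ Y)
    (hXc : (M ＼ {d}).connFn X ≤ 2) (hYc : (M ／ {c}).connFn Y ≤ 2)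
    (hXY : 2 ≤ (M ＼ {d} ／ {c}).connFn (X ∩ Y)) : M.connFn (X ∪ Y) ≤ 2 := by
  have hdX : d ∉ X := fun h => (hX h).2 rfl
  have hcY : c ∉ Y := fun h => (hY h).2 rfl
  have hcd : c ≠ d := fun h => hdX (h ▸ hcX)
  simp only [connFn, natRk_delete, delete_ground, contract_ground, sdiff_idem] at hXc hYc hXY
  have a1 := natRk_contract M {c} Y
  have a2 := natRk_contract M {c} ((M.E \ {c}) \ Y)
  have a3 := natRk_contract M {c} (M.E \ {c})
  have a4 := natRk_contract (M ＼ {d}) {c} (X ∩ Y)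
  have a5 := natRk_contract (M ＼ {d}) {c} (((M.E \ {d}) \ {c}) \ (X ∩ Y))
  have a6 := natRk_contract (M ＼ {d}) {c} ((M.E \ {d}) \ {c})
  simp only [natRk_delete] at a4 a5 a6
  have hcE : c ∈ M.E := (hX hcX).1
  have hdE : d ∈ M.E := (hY hdY).1
  have e0 : ({c} : Set α) \ {d} = {c} := by simp [hcd]
  have e1 : (M.E \ {c}) ∪ {c} = M.E := by simp [hcE]
  have e2 : (((M.E \ {d}) \ {c}) ∪ {c}) \ {d} = M.E \ {d} := by
    ext x; simp only [mem_sdiff, mem_union, mem_singleton_iff]; grind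
  have e3 : X \ {d} = X := by simp [hdX]
  rw [e0] at a4 a5 a6
  rw [e2] at a6
  rw [e1] at a3
  rw [e3] at hXc
  -- Submodularity for the two sides of the separations, with `c` added on the `Y` sides because
  -- ranks in `M ／ {c}` are ranks in `M` with `c` adjoined. The meet of the first pair and the join
  -- of the second measure `X ∩ Y` in `M ＼ {d} ／ {c}`.
  have s1 := M.natRk_submod X (Y ∪ {c})
  have s2 := M.natRk_submod ((M.E \ {d}) \ X) (((M.E \ {c}) \ Y) ∪ {c})
  have f1 : X ∩ (Y ∪ {c}) = (X ∩ Y ∪ {c}) \ {d} := by ext x; simp; grind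
  have f2 : X ∪ (Y ∪ {c}) = X ∪ Y := by ext x; simp; grind
  have f3 : ((M.E \ {d}) \ X) ∩ (((M.E \ {c}) \ Y) ∪ {c}) = M.E \ (X ∪ Y) := by
    ext x; simp; grind
  have f4 : ((M.E \ {d}) \ X) ∪ (((M.E \ {c}) \ Y) ∪ {c}) =
      ((((M.E \ {d}) \ {c}) \ (X ∩ Y)) ∪ {c}) \ {d} := by
    ext x; simp; grind
  have f5 : ((M.E \ {d}) \ X) \ {d} = (M.E \ {d}) \ X := by simp
  rw [f1, f2] at s1
  rw [f3, f4] at s2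
  rw [f5] at hXc
  rw [connFn]
  lia

/-- A single-element extension of a 3-connected matroid that is not 3-connected and increases
the connectivity of `A` is a parallel extension at an element of `A`. -/
lemma exists_parallel [M.Finite] (hd : d ∈ M.E) (hN : (M ＼ {d}).IsNConnected 3)
    (hM : ¬ M.IsNConnected 3) (hA : A ⊆ M.E \ {d}) (hnt : A.Nontrivial)
    (hle : (M ＼ {d}).connFn A ≤ 2) (hge : 3 ≤ M.connFn A) :
    ∃ a ∈ A, M.natRk {a} = 1 ∧ M.natRk {d} = 1 ∧ M.natRk {a, d} = 1 := by
  have hdA : d ∉ A := fun h => (hA h).2 rfl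
  have hNt : (M.E \ {d}).Nontrivial := hnt.mono hA
  have e1 : insert d (M.E \ {d}) = M.E := insert_sdiff_self_of_mem hd
  have e2 : insert d ((M.E \ {d}) \ A) = M.E \ A := by ext x; simp; grind
  have e3 : A \ {d} = A := by simp [hdA]
  have e7 : ((M.E \ {d}) \ A) \ {d} = (M.E \ {d}) \ A := by simp
  simp only [connFn, natRk_delete, delete_ground, sdiff_idem, e3, e7] at hle
  rw [connFn] at hge
  have i1 := M.natRk_insert_le d ((M.E \ {d}) \ A)
  have i2 : M.natRk (M.E \ {d}) ≤ M.natRk M.E := natRk_mono sdiff_subset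
  have i3 := M.natRk_insert_le d (M.E \ {d})
  rw [e1] at i3
  rw [e2] at i1
  -- `λ(A)` can only rise if `d` is outside the closure of the other side and is not a coloop.
  have hB : M.natRk (M.E \ A) = M.natRk ((M.E \ {d}) \ A) + 1 := by lia
  have hE : M.natRk (M.E \ {d}) = M.natRk M.E := by lia
  have hmod := M.natRk_union_le {d} ((M.E \ {d}) \ A)
  rw [singleton_union, e2] at hmod
  have hdle := M.natRk_insert_le d ∅
  rw [insert_empty_eq] at hdle
  have hemp : M.natRk ∅ = 0 := by simp [natRk]
  have hd1 : M.natRk {d} = 1 := by lia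
  have hsing : ∀ a ∈ M.E \ {d}, 1 ≤ (M ＼ {d}).connFn {a} := by
    intro a ha
    by_contra! hlt
    obtain ⟨b, hb, hba⟩ := hNt.exists_ne a
    refine hN 1 le_rfl (by simp) {a} ((M.E \ {d}) \ {a}) ⟨?_, disjoint_sdiff_right, by simp, ?_, ?_⟩
    · rw [union_sdiff_cancel (by simpa using ha)]; rfl
    · rw [Nat.cast_one, one_le_encard_iff_nonempty]
      exact ⟨b, hb, hba⟩
    · simpa using Int.le_sub_one_of_lt hlt
  simp only [IsNConnected, not_forall, not_not] at hM
  obtain ⟨k, hk1, hk3, U, V, hUV⟩ := hM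
  wlog hdV : d ∈ V generalizing U V with aux
  · exact aux V U hUV.symm ((hUV.union_eq.symm.subset hd).resolve_right hdV)
  have hU : U ⊆ M.E := subset_union_left.trans hUV.union_eq.subset
  have hV : V ⊆ M.E := subset_union_right.trans hUV.union_eq.subset
  have hdU : d ∉ U := hUV.disjoint.notMem_of_mem_right hdV
  have hdel := connFn_delete_le M {d} U
  rw [sdiff_singleton_eq_self hdU] at hdel
  -- Otherwise removing `d` leaves a `k`-separation of `M ＼ {d}`.
  have hsmall : ¬ (k : ℕ∞) ≤ (V \ {d}).encard := by
    refine fun hle => hN k hk1 hk3 U (V \ {d}) ⟨?_, hUV.disjoint.mono_right sdiff_subset,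
      hUV.le_left, hle, hdel.trans hUV.conn_le⟩
    rw [delete_ground, ← hUV.union_eq, union_sdiff_distrib, sdiff_singleton_eq_self hdU]
  have hVc := encard_sdiff_singleton_add_one hdV
  have hconn : M.connFn V ≤ k - 1 := hUV.symm.conn_le
  have hkV := hUV.le_right
  rw [← hVc] at hkV
  obtain rfl | rfl : k = 1 ∨ k = 2 := by lia
  · have : V \ {d} = ∅ := by
      by_contra hne
      exact hsmall (by simpa [one_le_encard_iff_nonempty] using nonempty_iff_ne_empty.2 hne)
    have hVd : V = {d} := by rw [← insert_sdiff_self_of_mem hdV, this, insert_empty_eq]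
    rw [hVd, connFn, hE] at hconn
    push_cast at hconn
    lia
  have hone : (V \ {d}).encard = 1 := by
    refine le_antisymm (Order.le_of_lt_add_one ?_) ?_
    · rw [one_add_one_eq_two]; exact not_le.1 hsmall
    · rw [Nat.cast_two, ← one_add_one_eq_two] at hkV
      exact (ENat.add_le_add_iff_right (by simp)).1 hkV
  obtain ⟨a, ha⟩ := encard_eq_one.1 hone
  have haV : a ∈ V \ {d} := ha ▸ rfl
  have had : a ∈ M.E \ {d} := ⟨hV haV.1, haV.2⟩
  have hVa : V = {a, d} := by rw [← insert_sdiff_self_of_mem hdV, ha, pair_comm]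
  have hs := hsing a had
  have hane : ({a} : Set α) \ {d} = {a} := by simpa using had.2
  have e4 : ((M.E \ {d}) \ {a}) \ {d} = M.E \ {a, d} := by ext x; simp; grind
  simp only [connFn, natRk_delete, delete_ground, sdiff_idem, hane, e4] at hs
  rw [hVa, connFn] at hconn
  have hle4 : M.natRk (M.E \ {a, d}) ≤ M.natRk (M.E \ {d}) := natRk_mono (by gcongr; simp)
  have hale := M.natRk_insert_le a ∅
  rw [insert_empty_eq] at hale
  have hda : M.natRk {d} ≤ M.natRk {a, d} := natRk_mono (by simp)
  have haa : M.natRk {a} ≤ M.natRk {a, d} := natRk_mono (by simp)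
  have key : M.natRk {a, d} = 1 ∧ M.natRk {a} = 1 := by
    push_cast at hconn
    constructor
    · lia
    · lia
  refine ⟨a, ?_, key.2, hd1, key.1⟩
  -- A parallel mate outside `A` would put `d` in the closure of the other side, against `hB`.
  by_contra haA
  have hsub := M.natRk_submod ((M.E \ {d}) \ A) {a, d}
  have e5 : ((M.E \ {d}) \ A) ∪ {a, d} = M.E \ A := by
    ext x; simp only [mem_sdiff, mem_union, mem_insert_iff, mem_singleton_iff]; grind
  have e6 : ((M.E \ {d}) \ A) ∩ {a, d} = {a} := by
    ext x; simp only [mem_sdiff, mem_inter_iff, mem_insert_iff, mem_singleton_iff]; grind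
  rw [e5, e6] at hsub
  lia

end Bridging

/-! ### Permutations of the elements. -/

section Relabelling

variable {α : Type*} {M N : Matroid α} {A B C D X Y : Set α} {a c d : α}

lemma connFn_map {β : Type*} {f : α → β} (M : Matroid α) (hf : InjOn f M.E) (hX : X ⊆ M.E) :
    (M.map f hf).connFn (f '' X) = M.connFn X := by
  rw [connFn, connFn, map_ground, ← hf.image_sdiff_subset hX, natRk_map M hf hX,
    natRk_map M hf sdiff_subset, natRk_map M hf Subset.rfl]

lemma mapEquiv_delete (σ : α ≃ α) (M : Matroid α) (D : Set α) :
    (M ＼ D).mapEquiv σ = M.mapEquiv σ ＼ (σ '' D) := by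
  refine ext_indep ?_ fun I _ => ?_
  · simp [image_sdiff σ.injective]
  · simp only [mapEquiv_indep_iff, delete_indep_iff]
    rw [← disjoint_image_iff σ.injective (s := σ.symm '' I), σ.image_symm_image]

lemma mapEquiv_contract (σ : α ≃ α) (M : Matroid α) (C : Set α) :
    (M ／ C).mapEquiv σ = M.mapEquiv σ ／ (σ '' C) := by
  rw [← dual_inj, dual_contract, mapEquiv_eq_map, map_dual, mapEquiv_eq_map, map_dual]
  simp only [dual_contract]
  exact mapEquiv_delete σ M✶ C

lemma IsMinor.mapEquiv (h : N ≤m M) (σ : α ≃ α) : N.mapEquiv σ ≤m M.mapEquiv σ := by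
  obtain ⟨C, D, rfl⟩ := h
  exact ⟨σ '' C, σ '' D, by rw [mapEquiv_delete, mapEquiv_contract]⟩

lemma Splits.of_mapEquiv {σ : α ≃ α} (h : (M.mapEquiv σ).Splits A B) :
    M.Splits (σ.symm '' A) (σ.symm '' B) := by
  obtain ⟨X, hAX, hX, hXB, hc⟩ := h
  have hXM : σ.symm '' X ⊆ M.E := by
    rw [← σ.symm_image_image M.E]
    exact image_mono hX
  refine ⟨σ.symm '' X, image_mono hAX, hXM, (disjoint_image_iff σ.symm.injective).2 hXB, ?_⟩
  rw [← connFn_map M σ.injective.injOn hXM, σ.image_symm_image]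
  exact hc

/-- Two parallel elements may be exchanged. -/
lemma mapEquiv_swap_delete [DecidableEq α] [M.Finite] (ha : a ∈ M.E) (hd : d ∈ M.E)
    (had : a ≠ d) (h1 : M.natRk {a} = 1) (h2 : M.natRk {d} = 1) (h3 : M.natRk {a, d} = 1) :
    (M ＼ {a}).mapEquiv (Equiv.swap a d) = M ＼ {d} := by
  have hE : Equiv.swap a d '' M.E = M.E := by
    ext x
    simp only [Equiv.image_eq_preimage_symm, Equiv.symm_swap, mem_preimage]
    rcases eq_or_ne x a with rfl | hxa
    · simp [ha, hd]
    rcases eq_or_ne x d with rfl | hxd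
    · simp [ha, hd]
    rw [Equiv.swap_apply_of_ne_of_ne hxa hxd]
  refine ext_indep ?_ fun I hI => ?_
  · rw [mapEquiv_ground_eq, delete_ground, image_sdiff (Equiv.injective _), hE]
    simp
  have hI' : I ⊆ M.E \ {d} := by
    rw [mapEquiv_ground_eq, delete_ground, image_sdiff (Equiv.injective _), hE] at hI
    simpa using hI
  have hdI : d ∉ I := fun h => (hI' h).2 rfl
  rw [mapEquiv_indep_iff, deleteElem_indep_iff, deleteElem_indep_iff, Equiv.symm_swap]
  have haS : a ∉ Equiv.swap a d '' I := by
    simpa [Equiv.image_eq_preimage_symm] using hdI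
  simp only [haS, hdI, not_false_eq_true, and_true]
  by_cases haI : a ∈ I
  · have him : Equiv.swap a d '' I = insert d (I \ {a}) := by
      ext x
      simp only [Equiv.image_eq_preimage_symm, Equiv.symm_swap, mem_preimage, mem_insert_iff,
        mem_sdiff, mem_singleton_iff]
      rcases eq_or_ne x a with rfl | hxa
      · simp [hdI, had]
      rcases eq_or_ne x d with rfl | hxd
      · simp [haI]
      rw [Equiv.swap_apply_of_ne_of_ne hxa hxd]
      simp [hxa, hxd]
    have hsub : insert d (I \ {a}) ⊆ M.E :=
      insert_subset hd (sdiff_subset.trans (hI'.trans sdiff_subset))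
    rw [him, indep_iff_natRk hsub, indep_iff_natRk (hI'.trans sdiff_subset), ← him,
      ncard_image_of_injective _ (Equiv.injective _), him]
    -- `I` and its image under the swap both have the rank of `I ∪ {a, d}`.
    have s1 := M.natRk_submod I {a, d}
    have s2 := M.natRk_submod (insert d (I \ {a})) {a, d}
    have e1 : I ∩ {a, d} = {a} := by ext x; simp; grind
    have e2 : insert d (I \ {a}) ∩ {a, d} = {d} := by ext x; simp; grind
    have e3 : insert d (I \ {a}) ∪ {a, d} = I ∪ {a, d} := by ext x; simp; grind
    rw [e1] at s1
    rw [e2, e3] at s2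
    have m1 : M.natRk I ≤ M.natRk (I ∪ {a, d}) := natRk_mono subset_union_left
    have m2 : M.natRk (insert d (I \ {a})) ≤ M.natRk (I ∪ {a, d}) :=
      e3 ▸ natRk_mono subset_union_left
    rw [show M.natRk (insert d (I \ {a})) = M.natRk I by lia]
  · have him : Equiv.swap a d '' I = I := by
      ext x
      simp only [Equiv.image_eq_preimage_symm, Equiv.symm_swap, mem_preimage]
      rcases eq_or_ne x a with rfl | hxa
      · simp [hdI, haI]
      rcases eq_or_ne x d with rfl | hxd
      · simp [hdI, haI]
      rw [Equiv.swap_apply_of_ne_of_ne hxa hxd]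
    rw [him]

/-- Finite multiple transitivity of the symmetric group. It replaces an injection defined on `N.E`
by a permutation, which can be inverted on all of `M`. -/
lemma exists_equiv_eqOn {f : α → α} {E : Set α} (hE : E.Finite) (hf : InjOn f E) :
    ∃ σ : α ≃ α, EqOn σ f E := by
  obtain ⟨n, ⟨ι⟩⟩ := hE.to_subtype.exists_equiv_fin
  let x : Fin n ↪ α := ι.symm.toEmbedding.trans (Function.Embedding.subtype _)
  let y : Fin n ↪ α := ι.symm.toEmbedding.trans ⟨fun e : E => f e, hf.injective⟩
  obtain ⟨σ, hσ⟩ := (Equiv.Perm.isMultiplyPretransitive α n).exists_smul_eq x y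
  refine ⟨σ, fun e he => ?_⟩
  have := DFunLike.congr_fun hσ (ι ⟨e, he⟩)
  simpa [x] using this.trans (congrArg (fun e : E => f e) (ι.symm_apply_apply ⟨e, he⟩))

end Relabelling

/-! ### The induction. -/

section Decomposer

variable {α : Type*} {𝓜 : Set (Matroid α)} {M N : Matroid α} {A B C D X : Set α} {c : α}

lemma connFn_eq_two [M.Finite] (hcard : A.encard = 4) (hA : M.IsCircuit A)
    (hA' : M.IsCocircuit A) : M.connFn A = 2 := by
  have hcard' : A.ncard = 4 := by rw [ncard, hcard]; rfl
  have h1 := hA.natRk_add_one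
  have h2 := hA'.isCircuit.natRk_add_one
  rw [connFn_eq_dual M hA.subset_ground]
  lia

/-- `A` is a four-element circuit-cocircuit of the 3-connected matroid `N` and of each of its
3-connected single-element extensions and coextensions in the class `𝓜`. -/
structure IsStableQuad (𝓜 : Set (Matroid α)) (N : Matroid α) (A : Set α) : Prop where
  minorClosed : IsMinorClosedClass 𝓜
  conn : N.IsNConnected 3
  encard_eq : A.encard = 4
  isCircuit : N.IsCircuit A
  isCocircuit : N.IsCocircuit A
  extension : ∀ M ∈ 𝓜, M.IsNConnected 3 → (M.IsSingleExtension N ∨ M.IsSingleCoextension N) →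
    M.IsCircuit A ∧ M.IsCocircuit A

lemma IsMinorClosedClass.dual (h : IsMinorClosedClass 𝓜) : IsMinorClosedClass {M | M✶ ∈ 𝓜} where
  finite M hM := ⟨(h.finite _ hM).ground_finite⟩
  minor_mem M hM M' hM' := h.minor_mem _ hM _ hM'.dual
  map_mem M hM f hf := by
    rw [mem_ofPred_eq, map_dual]
    exact h.map_mem _ hM f hf

/-- Extensions and coextensions trade places, which makes the cocircuit-only case the literal dual
of the circuit-only case. -/
lemma IsStableQuad.dual [N.Finite] (h : IsStableQuad 𝓜 N A) :
    IsStableQuad {M | M✶ ∈ 𝓜} N✶ A where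
  minorClosed := h.minorClosed.dual
  conn := h.conn.dual
  encard_eq := h.encard_eq
  isCircuit := h.isCocircuit
  isCocircuit := h.isCircuit.isCocircuit
  extension M hM hconn hext := by
    have : M.Finite := ⟨(h.minorClosed.finite _ hM).ground_finite⟩
    suffices hsuff : M✶.IsSingleExtension N ∨ M✶.IsSingleCoextension N by
      obtain ⟨h1, h2⟩ := h.extension M✶ hM hconn.dual hsuff
      exact ⟨by simpa using h2.isCircuit, h1⟩
    refine hext.symm.imp ?_ ?_
    · rintro ⟨e, he, heq⟩
      exact ⟨e, he, by rw [← dual_contract, heq, dual_dual]⟩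
    · rintro ⟨e, he, heq⟩
      exact ⟨e, he, by rw [← dual_delete, heq, dual_dual]⟩

/-- The dual of `exists_three_le_connFn`. That `N'` is a minor of every `M ／ {c}` lets it be
compared with the separation found in `M ／ {c}`. -/
lemma exists_three_le_connFn_of_not_isCocircuit [M.Finite] (hD : M.Coindep D)
    (hCD : Disjoint C D) (hcard : A.encard = 4) (hA : (M ／ C ＼ D).IsCircuit A)
    (hA' : (M ／ C ＼ D).IsCocircuit A) (hM : ¬ M.IsCocircuit A) :
    ∃ d ∈ D, ∃ N' : Matroid α, N' ≤m M ∧ (∀ c ∈ C, N' ≤m M ／ {c}) ∧ d ∈ N'.E ∧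
      N' ＼ {d} = M ／ C ＼ D ∧ 3 ≤ N'.connFn A := by
  have hdual : (M ／ C ＼ D)✶ = M✶ ／ D ＼ C := by
    rw [dual_contract_delete, contract_delete_comm _ hCD.symm]
  have hDE : D ⊆ M.E := hD.subset_ground
  obtain ⟨d, hdD, heq, hge⟩ := exists_three_le_connFn (M := M✶) (C := D) (D := C) (A := A)
    hD hCD.symm hcard (hdual ▸ hA'.isCircuit) (hdual ▸ hA.isCocircuit) hM
  have hmin : M✶ ／ (D \ {d}) ＼ C ≤m M✶ := contract_delete_isMinor _ _ _
  have hdC : d ∉ C := hCD.notMem_of_mem_right hdD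
  have : (M✶ ／ (D \ {d}) ＼ C).Finite := hmin.finite
  have hAN : A ⊆ (M✶ ／ (D \ {d}) ＼ C).E := by
    have : A ⊆ (M ／ C ＼ D).E := hA.subset_ground
    simp only [delete_ground, contract_ground, dual_ground] at this ⊢
    intro x hx
    have := this hx
    simp only [mem_sdiff] at this ⊢
    tauto
  refine ⟨d, hdD, (M✶ ／ (D \ {d}) ＼ C)✶, by simpa using hmin.dual, fun c hc => ?_, ?_, ?_, ?_⟩
  · rw [← dual_dual (M ／ {c}), dual_contract]
    refine IsMinor.dual ⟨D \ {d}, C, ?_⟩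
    have hcD : Disjoint (D \ {d}) {c} :=
      disjoint_singleton_right.2 fun h => hCD.notMem_of_mem_left hc h.1
    rw [delete_contract_delete _ _ _ _ hcD, singleton_union, insert_eq_of_mem hc]
  · exact ⟨⟨hDE hdD, fun h => h.2 rfl⟩, hdC⟩
  · rw [← dual_contract, heq, ← hdual, dual_dual]
  · rwa [connFn_dual _ hAN]

lemma inter_ground_eq (hA : A ⊆ N.E) (hAX : A ⊆ X) (hX : Disjoint X (N.E \ A)) : X ∩ N.E = A := by
  refine subset_antisymm (fun x hx => ?_) (subset_inter hAX hA)
  by_contra hxA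
  exact hX.notMem_of_mem_left hx.1 ⟨hx.2, hxA⟩

/-- If `c` were missed, `X` would meet `N.E` in exactly `A`, and monotonicity of `λ` would give
`λ_M(X) ≥ 3`. -/
lemma mem_of_connFn_le [M.Finite] (hNM : N ≤m M) (hN : ∀ x ∈ N.E, x ≠ c → x ∈ B ∪ A)
    (hA : A ⊆ N.E) (hAX : A ⊆ X) (hX : X ⊆ M.E) (hXB : Disjoint X B) (hX2 : M.connFn X ≤ 2)
    (h3 : 3 ≤ N.connFn A) : c ∈ X := by
  by_contra hc
  have hXN : X ∩ N.E = A := by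
    refine subset_antisymm (fun x hx => ?_) (subset_inter hAX hA)
    exact (hN x hx.2 (ne_of_mem_of_not_mem hx.1 hc)).resolve_left
      (hXB.notMem_of_mem_left hx.1)
  have := hNM.connFn_le hX hXN
  lia

/-- If `A` is a circuit but not a cocircuit of `M`, then a suitable element of `A` can be deleted
from `M` and its role in `N` taken over by a parallel element. -/
lemma IsStableQuad.splits_of_isCircuit (h : IsStableQuad 𝓜 N A) (hM : M ∈ 𝓜) (hD : M.Coindep D)
    (hCD : Disjoint C D) (hNM : N = M ／ C ＼ D) (hA : M.IsCircuit A) (hA' : ¬ M.IsCocircuit A)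
    (ih : ∀ M' ∈ 𝓜, N ≤m M' → M'.E.ncard < M.E.ncard → M'.Splits A (N.E \ A)) :
    M.Splits A (N.E \ A) := by
  classical
  have : M.Finite := h.minorClosed.finite M hM
  have : N.Finite := IsMinor.finite ⟨C, D, hNM⟩
  have hcirc := h.isCircuit
  have hcocirc := h.isCocircuit
  rw [hNM] at hcirc hcocirc
  obtain ⟨d, hdD, N', hN'M, -, hdN', hN'd, hge⟩ :=
    exists_three_le_connFn_of_not_isCocircuit hD hCD h.encard_eq hcirc hcocirc hA'
  rw [← hNM] at hN'd
  have : N'.Finite := hN'M.finite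
  have hAN : A ⊆ N.E := h.isCircuit.subset_ground
  have hAN' : A ⊆ N'.E \ {d} := by rw [← delete_ground, hN'd]; exact hAN
  have hnc : ¬ N'.IsNConnected 3 := by
    intro hc
    obtain ⟨h1, h2⟩ := h.extension N' (h.minorClosed.minor_mem M hM N' hN'M) hc
      (Or.inl ⟨d, hdN', hN'd⟩)
    have := connFn_eq_two h.encard_eq h1 h2
    lia
  have hnt : A.Nontrivial := by
    rw [← one_lt_encard_iff_nontrivial, h.encard_eq]
    norm_num
  obtain ⟨a, haA, ha1, hd1, had1⟩ := exists_parallel hdN' (hN'd ▸ h.conn) hnc hAN' hnt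
    (by rw [hN'd, connFn_eq_two h.encard_eq h.isCircuit h.isCocircuit]) hge
  have hdA : d ∉ A := fun hd => (hAN' hd).2 rfl
  have had : a ≠ d := ne_of_mem_of_not_mem haA hdA
  have haM : a ∈ M.E := hA.subset_ground haA
  have hdN : d ∉ N.E := by rw [← hN'd]; exact fun hd => hd.2 rfl
  have hswap := mapEquiv_swap_delete (hAN' haA).1 hdN' had ha1 hd1 had1
  have hdel : N' ＼ {a} ≤m M ＼ {a} := by
    obtain ⟨C', D', rfl⟩ := hN'M
    refine ⟨C', insert a D', ?_⟩
    have haC : a ∉ C' := (hAN' haA).1.1.2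
    rw [delete_contract_delete _ _ _ _ (by simpa), delete_delete]
    congr 1
    ext; simp
  -- The swap carries `N' ＼ {a}` to `N' ＼ {d} = N`, so `N` survives the loss of `a`.
  have hmin : N ≤m (M ＼ {a}).mapEquiv (Equiv.swap a d) := by
    rw [← hN'd, ← hswap]
    exact hdel.mapEquiv _
  have hmem : (M ＼ {a}).mapEquiv (Equiv.swap a d) ∈ 𝓜 :=
    h.minorClosed.map_mem _ (h.minorClosed.minor_mem M hM _ ⟨∅, {a}, by simp⟩) _
      (Equiv.injective _).injOn
  have hlt : ((M ＼ {a}).mapEquiv (Equiv.swap a d)).E.ncard < M.E.ncard := by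
    rw [mapEquiv_ground_eq, ncard_image_of_injective _ (Equiv.injective _)]
    exact ncard_sdiff_singleton_lt_of_mem haM M.ground_finite
  obtain ⟨X, hAX, hX, hXB, hXc⟩ := (ih _ hmem hmin hlt).of_mapEquiv
  rw [Equiv.symm_swap] at hAX hXB
  have haX : a ∉ X := fun ha => (hX ha).2 rfl
  have hAaX : A \ {a} ⊆ X := by
    rintro x ⟨hxA, hxa⟩
    exact hAX ⟨x, hxA, Equiv.swap_apply_of_ne_of_ne hxa (ne_of_mem_of_not_mem hxA hdA)⟩
  refine ⟨insert a X, ?_, insert_subset haM (hX.trans sdiff_subset), ?_, ?_⟩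
  · rw [← insert_sdiff_self_of_mem haA]
    exact insert_subset_insert hAaX
  · rw [disjoint_insert_left]
    refine ⟨fun ha => ha.2 haA, disjoint_left.2 fun x hxX hxB => hXB.notMem_of_mem_left hxX ?_⟩
    exact ⟨x, hxB, Equiv.swap_apply_of_ne_of_ne (ne_of_mem_of_not_mem haA hxB.2).symm
      (ne_of_mem_of_not_mem hxB.1 hdN)⟩
  · have hins : M.natRk (insert a X) = M.natRk X := natRk_insert_of_mem_closure
      (M.closure_subset_closure hAaX (hA.mem_closure_sdiff_singleton_of_mem haA))
    have e1 : M.E \ insert a X = ((M.E \ {a}) \ X) \ {a} := by ext x; simp; grind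
    have hmono : M.natRk (M.E \ {a}) ≤ M.natRk M.E := natRk_mono sdiff_subset
    simp only [connFn, natRk_delete, delete_ground, sdiff_idem, sdiff_singleton_eq_self haX] at hXc
    rw [connFn, hins, e1]
    lia

/-- The separation of a stable circuit-cocircuit from the rest of `N` persists in every member
of the class having `N` as a minor. -/
theorem IsStableQuad.splits (h : IsStableQuad 𝓜 N A) (hM : M ∈ 𝓜) (hNM : N ≤m M) :
    M.Splits A (N.E \ A) := by
  induction hn : M.E.ncard using Nat.strong_induction_on generalizing M with
  | _ n ih =>
  subst hn
  replace ih : ∀ M' ∈ 𝓜, N ≤m M' → M'.E.ncard < M.E.ncard → M'.Splits A (N.E \ A) :=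
    fun M' hM' hNM' hlt => ih _ hlt hM' hNM' rfl
  have : M.Finite := h.minorClosed.finite M hM
  have : N.Finite := hNM.finite
  have hAN : A ⊆ N.E := h.isCircuit.subset_ground
  have hAM : A ⊆ M.E := hAN.trans hNM.subset
  obtain ⟨C, D, hC, hD, hCD, hNCD⟩ := hNM.exists_indep_coindep
  by_cases hA : M.IsCircuit A
  · by_cases hA' : M.IsCocircuit A
    · exact ⟨A, Subset.rfl, hAM, disjoint_sdiff_right,
        (connFn_eq_two h.encard_eq hA hA').le⟩
    · exact h.splits_of_isCircuit hM hD hCD hNCD hA hA' ih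
  by_cases hA' : M.IsCocircuit A
  · have hM' : M✶ ∈ {M | M✶ ∈ 𝓜} := by simpa using hM
    have hs := h.dual.splits_of_isCircuit (M := M✶) (C := D) (D := C) hM' (by simpa using hC)
      hCD.symm (by rw [hNCD, dual_contract_delete, contract_delete_comm _ hCD.symm])
      hA'.isCircuit (by simpa using hA) ?_
    · simpa using hs.dual
    intro M₁ hM₁ hNM₁ hlt
    have : M₁✶.Finite := h.minorClosed.finite _ hM₁
    simpa using (ih M₁✶ hM₁ (by simpa using hNM₁.dual) hlt).dual
  have hcirc := h.isCircuit
  have hcocirc := h.isCocircuit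
  rw [hNCD] at hcirc hcocirc
  obtain ⟨c, hcC, hceq, hc3⟩ := exists_three_le_connFn hC hCD h.encard_eq hcirc hcocirc hA
  obtain ⟨d, hdD, Nd, -, hNdM, hdNd, hdeq, hd3⟩ :=
    exists_three_le_connFn_of_not_isCocircuit hD hCD h.encard_eq hcirc hcocirc hA'
  rw [← hNCD] at hceq hdeq
  have hcM : c ∈ M.E := hC.subset_ground hcC
  have hdM : d ∈ M.E := hD.subset_ground hdD
  have hdC : d ∉ C := hCD.notMem_of_mem_right hdD
  have hcD : c ∉ D := hCD.notMem_of_mem_left hcC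
  have hcd : c ≠ d := ne_of_mem_of_not_mem hcC hdC
  have hNdel : N ≤m M ＼ {d} := by
    refine ⟨C, D, ?_⟩
    rw [delete_contract_delete _ _ _ _ (by simpa), singleton_union, insert_eq_of_mem hdD, hNCD]
  have hNc : M ／ (C \ {c}) ＼ D ≤m M ＼ {d} := by
    refine ⟨C \ {c}, D, ?_⟩
    rw [delete_contract_delete _ _ _ _ (by simp [hdC]), singleton_union, insert_eq_of_mem hdD]
  have hNcon : N ≤m M ／ {c} := by
    refine ⟨C \ {c}, D, ?_⟩
    rw [contract_contract, singleton_union, insert_sdiff_self_of_mem hcC, hNCD]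
  have hNboth : N ≤m M ＼ {d} ／ {c} := by
    refine ⟨C \ {c}, D, ?_⟩
    rw [contract_contract, singleton_union, insert_sdiff_self_of_mem hcC,
      delete_contract_delete _ _ _ _ (by simpa), singleton_union, insert_eq_of_mem hdD, hNCD]
  obtain ⟨X, hAX, hX, hXB, hXc⟩ := ih (M ＼ {d})
    (h.minorClosed.minor_mem M hM _ ⟨∅, {d}, by simp⟩) hNdel
    (ncard_sdiff_singleton_lt_of_mem hdM M.ground_finite)
  obtain ⟨Y, hAY, hY, hYB, hYc⟩ := ih (M ／ {c})
    (h.minorClosed.minor_mem M hM _ ⟨{c}, ∅, by simp⟩) hNcon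
    (ncard_sdiff_singleton_lt_of_mem hcM M.ground_finite)
  have hcX : c ∈ X := by
    refine mem_of_connFn_le hNc (fun x hx hxc => ?_) ?_ hAX hX hXB hXc hc3
    · rw [sdiff_union_of_subset hAN, ← hceq]
      exact ⟨hx, hxc⟩
    · exact hAN.trans (hceq ▸ sdiff_subset)
  have hdY : d ∈ Y := by
    refine mem_of_connFn_le (hNdM c hcC) (fun x hx hxd => ?_) ?_ hAY hY hYB hYc hd3
    · rw [sdiff_union_of_subset hAN, ← hdeq]
      exact ⟨hx, hxd⟩
    · exact hAN.trans (hdeq ▸ sdiff_subset)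
  have hXY : 2 ≤ (M ＼ {d} ／ {c}).connFn (X ∩ Y) := by
    rw [← connFn_eq_two h.encard_eq h.isCircuit h.isCocircuit]
    refine hNboth.connFn_le (fun x hx => ⟨hX hx.1, (hY hx.2).2⟩)
      (inter_ground_eq hAN (subset_inter hAX hAY) (hXB.mono_left inter_subset_left))
  exact ⟨X ∪ Y, hAX.trans subset_union_left,
    union_subset (hX.trans sdiff_subset) (hY.trans sdiff_subset),
    disjoint_union_left.2 ⟨hXB, hYB⟩, splits_of_delete_of_contract hX hY hcX hdY hXc hYc hXY⟩

end Decomposer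

end Matroid

theorem corollary1p2 {α : Type*} (𝓜 : Set (Matroid α)) (h𝓜 : Matroid.IsMinorClosedClass 𝓜)
    (N : Matroid α) (hN : N ∈ 𝓜) (hconn : N.IsNConnected 3)
    (hwheel : ¬ N.IsWheel) (hwhirl : ¬ N.IsWhirl)
    (A B : Set α) (hAB : N.IsExactSeparation 3 A B)
    (hnonmin : ¬ N.IsMinimalExactSeparation 3 A B)
    (hcard : A.encard = 4) (hcircuit : N.IsCircuit A) (hcocircuit : N.IsCocircuit A)
    (hext : ∀ M ∈ 𝓜, M.IsNConnected 3 → (M.IsSingleExtension N ∨ M.IsSingleCoextension N) →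
      M.IsCircuit A ∧ M.IsCocircuit A) :
    ∀ M ∈ 𝓜, M.IsNConnected 3 → M.HasMinor N → N.IsDecomposerFor 3 A B M := by
  intro M hM _ _ f hf hfM
  have : M.Finite := h𝓜.finite M hM
  have : N.Finite := h𝓜.finite N hN
  have hquad : Matroid.IsStableQuad 𝓜 N A := ⟨h𝓜, hconn, hcard, hcircuit, hcocircuit, hext⟩
  have hAN : A ⊆ N.E := hcircuit.subset_ground
  have hB : N.E \ A = B := by
    rw [← hAB.1.union_eq, union_sdiff_left, hAB.1.disjoint.symm.sdiff_eq_left]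
  have hBN : B ⊆ N.E := hB ▸ sdiff_subset
  obtain ⟨σ, hσ⟩ := Matroid.exists_equiv_eqOn N.ground_finite hf
  have hNf : N.map f hf = N.mapEquiv σ := by
    refine Matroid.ext_indep (by simp [hσ.image_eq]) fun I _ => ?_
    rw [Matroid.mapEquiv_eq_map, Matroid.map_indep_iff, Matroid.map_indep_iff]
    refine exists_congr fun J => and_congr_right fun hJ => ?_
    rw [(hσ.mono hJ.subset_ground).image_eq]
  -- Relabelling `M` backwards instead of `N` forwards makes `N` itself the minor.
  have hmin : N ≤m M.mapEquiv σ.symm := by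
    have h := hfM.mapEquiv σ.symm
    rw [hNf] at h
    convert h
    refine Matroid.ext_indep (by simp) fun I _ => ?_
    simp
  have hs := (hquad.splits (h𝓜.map_mem M hM σ.symm σ.symm.injective.injOn) hmin).of_mapEquiv
  rw [hB, σ.symm_symm, (hσ.mono hAN).image_eq, (hσ.mono hBN).image_eq] at hs
  obtain ⟨X, hAX, hX, hXB, hXc⟩ := hs
  have hBX : f '' B ⊆ M.E \ X := subset_sdiff.2
    ⟨(image_mono hBN).trans hfM.subset, hXB.symm⟩
  have hge : 2 ≤ M.connFn X := by
    rw [← Matroid.connFn_eq_two hcard hcircuit hcocircuit, ← Matroid.connFn_map N hf hAN]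
    refine hfM.connFn_le hX (Matroid.inter_ground_eq (image_mono hAN) hAX ?_)
    rw [Matroid.map_ground, ← hf.image_sdiff_subset hAN, hB]
    exact hXB
  refine ⟨X, M.E \ X, ⟨⟨union_sdiff_cancel hX, disjoint_sdiff_right, ?_, ?_, ?_⟩, ?_⟩, hAX, hBX⟩
  · exact hAB.1.le_left.trans ((hf.mono hAN).encard_image ▸ encard_le_encard hAX)
  · exact hAB.1.le_right.trans ((hf.mono hBN).encard_image ▸ encard_le_encard hBX)
  · push_cast; lia
  · push_cast; lia
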